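/- Let $\mathfrak g=\mathcal W_1^{++}$ be the complex Lie algebra with basis $\{d_i \mid i\in\mathbb Z_{\ge 0}\}$ and brackets $[d_m,d_n]=(m-n)\,d_{m+n}$ for all $m,n\ge 0$. Fix an integer $k\ge 1$, let $\mathfrak p_k=\mathrm{Span}_{\mathbb C}\{d_i\mid i\ge k\}$, which is an ideal of $\mathfrak g$, and let $\phi_k:\mathfrak p_k\to\mathbb C$ be a nonzero Lie algebra homomorphism (where $\mathbb C$ is the one-dimensional abelian Lie algebra). Let $\mathbb C w_{\phi_k}$ be the one-dimensional $\mathfrak p_k$-module on which $x\in\mathfrak p_k$ acts as the scalar $\phi_k(x)$, and let $$W(\phi_k)=\mathrm{Ind}_{\mathfrak p_k}^{\mathfrak g}\,\mathbb C w_{\phi_k}=\mathcal U(\mathfrak g)\otimes_{\mathcal U(\mathfrak p_k)}\mathbb C w_{\phi_k}$$ be the induced $\mathfrak g$-module, called the universal quasi-Whittaker module of type $\phi_k$. Then $W(\phi_k)$ is an irreducible $\mathfrak g$-module if and only if $\phi_k(d_{2k-1})\neq 0$ or $\phi_k(d_{2k})\neq 0$. -/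

import Mathlib

open scoped TensorProduct

noncomputable section

/-! ## The Lie algebra `W₁⁺⁺` -/

/-- The underlying complex vector space of `W₁⁺⁺`, with basis `d i`, `i : ℕ`. -/
def WittBorel : Type := ℕ →₀ ℂ

namespace WittBorel

instance : AddCommGroup WittBorel := inferInstanceAs (AddCommGroup (ℕ →₀ ℂ))

instance : Module ℂ WittBorel := inferInstanceAs (Module ℂ (ℕ →₀ ℂ))

/-- The family `d i`, `i : ℕ`, as a basis of `W₁⁺⁺`. -/
def basis : Module.Basis ℕ ℂ WittBorel := Module.Basis.ofRepr (LinearEquiv.refl ℂ (ℕ →₀ ℂ))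

/-- The basis vector `d i` of `W₁⁺⁺`. -/
def d (i : ℕ) : WittBorel := basis i

theorem d_induction {P : WittBorel → Prop} (hd : ∀ i, P (d i)) (h0 : P 0)
    (hadd : ∀ x y, P x → P y → P (x + y)) (hsmul : ∀ (c : ℂ) x, P x → P (c • x))
    (x : WittBorel) : P x := by
  have hx : x ∈ Submodule.span ℂ (Set.range basis) := by
    rw [basis.span_eq]
    exact Submodule.mem_top
  induction hx using Submodule.span_induction with
  | mem y hy =>
    obtain ⟨i, rfl⟩ := hy
    exact hd i
  | zero => exact h0
  | add y z _ _ hy hz => exact hadd y z hy hz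
  | smul c y _ hy => exact hsmul c y hy

/-- The bilinear map with `(d m, d n) ↦ (m - n) d (m + n)`, the difference being taken in `ℂ`. -/
def bracketₗ : WittBorel →ₗ[ℂ] WittBorel →ₗ[ℂ] WittBorel :=
  basis.constr ℂ fun m => basis.constr ℂ fun n => ((m : ℂ) - (n : ℂ)) • d (m + n)

theorem bracketₗ_d (m n : ℕ) : bracketₗ (d m) (d n) = ((m : ℂ) - (n : ℂ)) • d (m + n) := by
  simp [bracketₗ, d, Module.Basis.constr_basis]

theorem bracketₗ_swap (x y : WittBorel) : bracketₗ x y = -bracketₗ y x := by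
  have h : bracketₗ = -bracketₗ.flip := by
    refine basis.ext fun m => basis.ext fun n => ?_
    change bracketₗ (d m) (d n) = -bracketₗ (d n) (d m)
    rw [bracketₗ_d, bracketₗ_d, add_comm n m, ← neg_smul, neg_sub]
  exact LinearMap.congr_fun₂ h x y

theorem bracketₗ_self (x : WittBorel) : bracketₗ x x = 0 := by
  have h := bracketₗ_swap x x
  have h2 : (2 : ℂ) • bracketₗ x x = 0 := by
    rw [two_smul]
    nth_rewrite 1 [h]
    exact neg_add_cancel _
  exact (smul_eq_zero.mp h2).resolve_left two_ne_zero

theorem bracketₗ_jacobi (x y z : WittBorel) :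
    bracketₗ x (bracketₗ y z) = bracketₗ (bracketₗ x y) z + bracketₗ y (bracketₗ x z) := by
  induction x using d_induction with
  | h0 => simp
  | hadd a b ha hb =>
    simp only [map_add, LinearMap.add_apply, ha, hb]
    abel
  | hsmul c a ha => simp only [map_smul, LinearMap.smul_apply, ha, smul_add]
  | hd m =>
    induction y using d_induction with
    | h0 => simp
    | hadd a b ha hb =>
      simp only [map_add, LinearMap.add_apply, ha, hb]
      abel
    | hsmul c a ha => simp only [map_smul, LinearMap.smul_apply, ha, smul_add]
    | hd n =>
      induction z using d_induction with
      | h0 => simp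
      | hadd a b ha hb =>
        simp only [map_add, ha, hb]
        abel
      | hsmul c a ha => simp only [map_smul, ha, smul_add]
      | hd r =>
        simp only [bracketₗ_d, map_smul, LinearMap.smul_apply, smul_smul, Nat.cast_add]
        rw [← add_assoc m n r, add_left_comm n m r, ← add_assoc m n r, ← add_smul]
        congr 1
        ring

instance : LieRing WittBorel where
  bracket x y := bracketₗ x y
  add_lie x y z := by simp
  lie_add x y z := by simp
  lie_self := bracketₗ_self
  leibniz_lie := bracketₗ_jacobi

instance : LieAlgebra ℂ WittBorel where
  lie_smul c x y := map_smul (bracketₗ x) c y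

theorem d_lie_d (m n : ℕ) : ⁅d m, d n⁆ = ((m : ℂ) - (n : ℂ)) • d (m + n) := bracketₗ_d m n

/-- The ideal `𝔭ₖ` of `W₁⁺⁺` spanned by the `d i` with `i ≥ k`. -/
def p (k : ℕ) : LieIdeal ℂ WittBorel where
  toSubmodule := Submodule.span ℂ (d '' Set.Ici k)
  lie_mem := by
    intro x y hy
    change y ∈ Submodule.span ℂ (d '' Set.Ici k) at hy
    change bracketₗ x y ∈ Submodule.span ℂ (d '' Set.Ici k)
    induction hy using Submodule.span_induction with
    | zero => simp
    | add a b _ _ ha hb =>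
      rw [map_add]
      exact add_mem ha hb
    | smul c a _ ha =>
      rw [map_smul]
      exact Submodule.smul_mem _ c ha
    | mem y hy =>
      obtain ⟨n, hn, rfl⟩ := hy
      induction x using d_induction with
      | h0 => simp
      | hadd a b ha hb =>
        rw [map_add, LinearMap.add_apply]
        exact add_mem ha hb
      | hsmul c a ha =>
        rw [map_smul, LinearMap.smul_apply]
        exact Submodule.smul_mem _ c ha
      | hd m =>
        rw [bracketₗ_d]
        exact Submodule.smul_mem _ _
          (Submodule.subset_span ⟨m + n, le_trans (Set.mem_Ici.mp hn) (Nat.le_add_left n m), rfl⟩)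

/-- The basis vector `d i`, for `i ≥ k`, as an element of `𝔭ₖ`. -/
def dp (k i : ℕ) (h : k ≤ i) : p k := ⟨d i, Submodule.subset_span ⟨i, h, rfl⟩⟩

end WittBorel

/-! ## Induced modules -/

section Induced

attribute [local instance 100] LieRing.ofAssociativeRing

variable {L : Type*} [LieRing L] [LieAlgebra ℂ L]

/-- The algebra homomorphism `U(𝔭) → U(L)` induced by the inclusion of an ideal `𝔭` of `L`. -/
def envelopingIncl (𝔭 : LieIdeal ℂ L) :
    UniversalEnvelopingAlgebra ℂ 𝔭 →ₐ[ℂ] UniversalEnvelopingAlgebra ℂ L :=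
  UniversalEnvelopingAlgebra.lift ℂ ((UniversalEnvelopingAlgebra.ι ℂ).comp 𝔭.incl)

/-- The `U(L)`-submodule of `U(L) ⊗_ℂ N` spanned by the elements `u a ⊗ n - u ⊗ a n` with `u` in
`U(L)`, `a` in `U(𝔭)` and `n` in `N`, for a representation `ρ` of the ideal `𝔭` on `N`. -/
def balancedRelations {𝔭 : LieIdeal ℂ L} {N : Type*} [AddCommGroup N] [Module ℂ N]
    (ρ : 𝔭 →ₗ⁅ℂ⁆ Module.End ℂ N) :
    Submodule (UniversalEnvelopingAlgebra ℂ L) (UniversalEnvelopingAlgebra ℂ L ⊗[ℂ] N) :=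
  Submodule.span (UniversalEnvelopingAlgebra ℂ L)
    {t | ∃ (u : UniversalEnvelopingAlgebra ℂ L) (a : UniversalEnvelopingAlgebra ℂ 𝔭) (n : N),
      t = (u * envelopingIncl 𝔭 a) ⊗ₜ[ℂ] n
        - u ⊗ₜ[ℂ] (UniversalEnvelopingAlgebra.lift ℂ ρ a n)}

/-- The induced module `Ind_𝔭^L N = U(L) ⊗_{U(𝔭)} N`, for a representation `ρ` of the ideal `𝔭`
on `N`. -/
def IndModule {𝔭 : LieIdeal ℂ L} {N : Type*} [AddCommGroup N] [Module ℂ N]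
    (ρ : 𝔭 →ₗ⁅ℂ⁆ Module.End ℂ N) : Type _ :=
  (UniversalEnvelopingAlgebra ℂ L ⊗[ℂ] N) ⧸ balancedRelations ρ

namespace IndModule

variable {𝔭 : LieIdeal ℂ L} {N : Type*} [AddCommGroup N] [Module ℂ N]
  (ρ : 𝔭 →ₗ⁅ℂ⁆ Module.End ℂ N)

instance : AddCommGroup (IndModule ρ) :=
  inferInstanceAs (AddCommGroup ((UniversalEnvelopingAlgebra ℂ L ⊗[ℂ] N) ⧸ balancedRelations ρ))

instance : Module (UniversalEnvelopingAlgebra ℂ L) (IndModule ρ) :=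
  inferInstanceAs (Module (UniversalEnvelopingAlgebra ℂ L)
    ((UniversalEnvelopingAlgebra ℂ L ⊗[ℂ] N) ⧸ balancedRelations ρ))

instance : Module ℂ (IndModule ρ) :=
  inferInstanceAs (Module ℂ ((UniversalEnvelopingAlgebra ℂ L ⊗[ℂ] N) ⧸ balancedRelations ρ))

instance : IsScalarTower ℂ (UniversalEnvelopingAlgebra ℂ L) (IndModule ρ) :=
  inferInstanceAs (IsScalarTower ℂ (UniversalEnvelopingAlgebra ℂ L)
    ((UniversalEnvelopingAlgebra ℂ L ⊗[ℂ] N) ⧸ balancedRelations ρ))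

/-- An element of `L` acts on the induced module through its image in `U(L)`. -/
instance : LieRingModule L (IndModule ρ) where
  bracket x m := (UniversalEnvelopingAlgebra.ι ℂ x : UniversalEnvelopingAlgebra ℂ L) • m
  add_lie x y m := by
    rw [map_add, add_smul]
  lie_add x m n := smul_add _ m n
  leibniz_lie x y m := by
    change UniversalEnvelopingAlgebra.ι ℂ x • UniversalEnvelopingAlgebra.ι ℂ y • m =
      UniversalEnvelopingAlgebra.ι ℂ ⁅x, y⁆ • m +
        UniversalEnvelopingAlgebra.ι ℂ y • UniversalEnvelopingAlgebra.ι ℂ x • m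
    rw [LieHom.map_lie, LieRing.of_associative_ring_bracket, sub_smul, mul_smul, mul_smul,
      sub_add_cancel]

instance : LieModule ℂ L (IndModule ρ) where
  smul_lie c x m := by
    change UniversalEnvelopingAlgebra.ι ℂ (c • x) • m = c • UniversalEnvelopingAlgebra.ι ℂ x • m
    rw [map_smul, smul_assoc]
  lie_smul c x m := by
    change UniversalEnvelopingAlgebra.ι ℂ x • c • m = c • UniversalEnvelopingAlgebra.ι ℂ x • m
    rw [smul_algebra_smul_comm]

end IndModule

/-- The one-dimensional representation of `𝔭` on `ℂ w_φ = ℂ` in which `x` acts as the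
scalar `φ x`. -/
def characterRep {𝔭 : LieIdeal ℂ L} (φ : LieAlgebra.LieCharacter ℂ 𝔭) :
    𝔭 →ₗ⁅ℂ⁆ Module.End ℂ ℂ :=
  { toFun := fun x => φ x • (1 : Module.End ℂ ℂ)
    map_add' := fun x y => by rw [map_add, add_smul]
    map_smul' := fun c x => by rw [map_smul, smul_assoc, RingHom.id_apply]
    map_lie' := fun {x y} => by
      rw [LieAlgebra.lieCharacter_apply_lie, zero_smul, LieRing.of_associative_ring_bracket,
        smul_mul_smul_comm, smul_mul_smul_comm, mul_comm (φ y), sub_self] }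

/-- The universal quasi-Whittaker module `W(φ) = Ind_𝔭^L ℂ w_φ` of type `φ`. -/
abbrev UniversalQuasiWhittaker {𝔭 : LieIdeal ℂ L} (φ : LieAlgebra.LieCharacter ℂ 𝔭) : Type _ :=
  IndModule (characterRep φ)

end Induced

end

/-! Write `w` for the generator. Since `φ` kills brackets of `𝔭ₖ`, `φ (d i) = 0` for `i > 2k`.

Sufficiency: let `r`, equal to `2k - 1` or `2k`, be the last index with `φ (d r) ≠ 0`, and let `Vᵢ`
be the span of `w` under the `d j`, `j ≥ i`. Then `V₀ = W(φ)` and `V_k = ℂ w`, and each vector of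
`Vᵢ` is a sum of terms `dᵢⁿ uₙ` with `uₙ` in `Vᵢ₊₁`. For `i < k` the operator `T = d (r - i) - φ (d
(r - i))` kills `Vᵢ₊₁`, and its commutator with `dᵢ` is, up to a multiple of `T` when `i = 0`, the
nonzero scalar `(r - 2i) φ (d r)`. So `T` acts like differentiation in `dᵢ`: applied as often as the
top power of `dᵢ`, it leaves a nonzero multiple of the top coefficient. Hence a nonzero submodule
meets every `Vᵢ` down to `V_k`, and so contains `w` (`generator_mem_of_stable`).

Necessity: for `k ≥ 2`, if both values vanish, `φ` extends to `𝔭ₖ₋₁` with any value `c` at `d (k -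
1)`. Irreducibility makes the map from `W(φ)` to a module realising the extension injective, so `d
(k - 1) w = c w` for all `c`, which is absurd as `w ≠ 0`. For `k = 1` the vanishing forces `φ = 0`.

Both directions need characters to be realised on nonzero vectors; `exists_wittRep_apply_eq` does
this by inducing explicitly, adjoining one `d j` at a time. -/

noncomputable section

/-! ## Representations given by operators on the basis -/

/-- The operators `D i`, `i ≥ j`, satisfy the commutation relations of the `d i`, `i ≥ j`. -/
def IsWittRep {V : Type*} [AddCommGroup V] [Module ℂ V] (j : ℕ) (D : ℕ → Module.End ℂ V) : Prop :=
  ∀ m n, j ≤ m → j ≤ n → ∀ x, D m (D n x) = D n (D m x) + ((m : ℂ) - n) • D (m + n) x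

namespace WittInduction

variable {V : Type*} [AddCommGroup V] [Module ℂ V] (j : ℕ) (D : ℕ → Module.End ℂ V)

/-- Multiplication by the adjoined generator `d j` on `ℂ[d j] ⊗ V`. -/
def shift : Module.End ℂ (ℕ →₀ V) := Finsupp.lmapDomain V ℂ Nat.succ

theorem shift_single (n : ℕ) (v : V) :
    shift (Finsupp.single n v) = Finsupp.single (n + 1) v := by
  simp [shift]

/-- The action of `d m`, `m > j`, on `(d j) ^ n ⊗ V`. -/
def layer : ℕ → ℕ → V →ₗ[ℂ] (ℕ →₀ V)
  | 0, m => Finsupp.lsingle 0 ∘ₗ D m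
  | n + 1, m => shift ∘ₗ layer n m + ((m : ℂ) - j) • layer n (m + j)

/-- The operators of the module induced from the span of the `d i`, `i > j`, to that of the
`d i`, `i ≥ j`. -/
def op (m : ℕ) : Module.End ℂ (ℕ →₀ V) :=
  if m = j then shift else Finsupp.lsum ℂ fun n => layer j D n m

theorem op_self : op j D j = shift := if_pos rfl

theorem op_single {m : ℕ} (hm : m ≠ j) (n : ℕ) (v : V) :
    op j D m (Finsupp.single n v) = layer j D n m v := by
  simp [op, hm]

/-- The recursion in `layer` is exactly the rule for moving `d m` past one factor `d j`. -/
theorem op_shift {m : ℕ} (hm : j < m) (x : ℕ →₀ V) :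
    op j D m (shift x) = shift (op j D m x) + ((m : ℂ) - j) • op j D (m + j) x := by
  induction x using Finsupp.induction_linear with
  | zero => simp
  | add x y hx hy =>
    simp only [map_add, hx, hy, smul_add]
    abel
  | single n v =>
    rw [shift_single, op_single j D hm.ne', op_single j D hm.ne',
      op_single j D (show m + j ≠ j by omega)]
    rfl

/-- Moving both operators past one `d j` reduces degree `N + 1` to degree `N` at `(m, n)`, `(m + j,
n)` and `(m, n + j)`; the coefficients then match by the Jacobi identity. -/
theorem op_comm_single (hD : IsWittRep (j + 1) D) (v : V) (N : ℕ) :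
    ∀ m n, j < m → j < n → op j D m (op j D n (Finsupp.single N v)) =
      op j D n (op j D m (Finsupp.single N v)) +
        ((m : ℂ) - n) • op j D (m + n) (Finsupp.single N v) := by
  induction N with
  | zero =>
    intro m n hm hn
    have h0 : ∀ m, j < m → ∀ u : V,
        op j D m (Finsupp.single 0 u) = Finsupp.single 0 (D m u) := fun m hm u => by
      rw [op_single j D hm.ne']
      rfl
    rw [h0 n hn, h0 m hm, h0 m hm, h0 n hn, h0 (m + n) (by omega), hD m n hm hn,
      Finsupp.single_add, Finsupp.smul_single]
  | succ N ih =>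
    intro m n hm hn
    rw [← shift_single]
    generalize Finsupp.single N v = x at ih
    simp only [op_shift j D hm, op_shift j D hn, op_shift j D (show j < m + n by omega), map_add,
      map_smul]
    rw [ih m n hm hn, ih (m + j) n (by omega) hn, ih m (n + j) hm (by omega),
      show m + j + n = m + n + j by omega, show m + (n + j) = m + n + j by omega]
    simp only [map_add, map_smul, Nat.cast_add]
    module

theorem isWittRep_op (hD : IsWittRep (j + 1) D) : IsWittRep j (op j D) := by
  intro m n hm hn x
  rcases hm.eq_or_lt with rfl | hm
  · rcases hn.eq_or_lt with rfl | hn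
    · simp
    · rw [op_self, op_shift j D hn, add_comm n j]
      module
  · rcases hn.eq_or_lt with rfl | hn
    · rw [op_self, op_shift j D hm]
    · induction x using Finsupp.induction_linear with
      | zero => simp
      | add x y hx hy =>
        simp only [map_add, hx, hy, smul_add]
        abel
      | single N v => exact op_comm_single j D hD v N m n hm hn

end WittInduction

/-- A function `f` on the indices that vanishes on brackets of the `d i`, `i ≥ k`, is realised on
a nonzero vector of a representation of `W₁⁺⁺`. -/
theorem exists_wittRep_apply_eq (k : ℕ) (f : ℕ → ℂ)
    (hf : ∀ m n, k ≤ m → k ≤ n → ((m : ℂ) - n) * f (m + n) = 0) :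
    ∃ (V : Type) (_ : AddCommGroup V) (_ : Module ℂ V) (D : ℕ → Module.End ℂ V) (v : V),
      IsWittRep 0 D ∧ v ≠ 0 ∧ ∀ i, k ≤ i → D i v = f i • v := by
  suffices h : ∀ j ≤ k, ∃ (V : Type) (_ : AddCommGroup V) (_ : Module ℂ V)
      (D : ℕ → Module.End ℂ V) (v : V),
      IsWittRep j D ∧ v ≠ 0 ∧ ∀ i, k ≤ i → D i v = f i • v from h 0 k.zero_le
  intro j hj
  induction hj using Nat.decreasingInduction with
  | self =>
    refine ⟨ℂ, inferInstance, inferInstance, fun i => f i • 1, 1, ?_, one_ne_zero, fun i _ => rfl⟩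
    intro m n hm hn x
    simp only [LinearMap.smul_apply, Module.End.one_apply, smul_eq_mul]
    linear_combination -x * hf m n hm hn
  | of_succ j hj ih =>
    obtain ⟨V, _, _, D, v, hD, hv, hDv⟩ := ih
    refine ⟨ℕ →₀ V, inferInstance, inferInstance, WittInduction.op j D, Finsupp.single 0 v,
      WittInduction.isWittRep_op j D hD, by simpa using hv, fun i hi => ?_⟩
    -- Here `i ≥ k > j`, so `d i` is not the adjoined generator and acts on degree zero as it did on
    -- `V`.
    rw [WittInduction.op_single j D (by omega), Finsupp.smul_single, ← hDv i hi]
    rfl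

/-! ## Reduction of vectors -/

section Reduction

variable {V : Type*} [AddCommGroup V] [Module ℂ V]

/-- Operators with `T D = D T + e T + c` on a stable subspace `M`: powers of `T` strip powers
of `D` from a vector killed by `T`. -/
theorem pow_apply_pow_of_comm {T D : Module.End ℂ V} {M : Submodule ℂ V} {e c : ℂ}
    (hT : ∀ x ∈ M, T x ∈ M) (hD : ∀ x ∈ M, D x ∈ M)
    (h : ∀ x ∈ M, T (D x) = D (T x) + e • T x + c • x) {u : V} (hu : u ∈ M) (hTu : T u = 0)
    (n : ℕ) : (T ^ n) ((D ^ n) u) = ((n.factorial : ℂ) * c ^ n) • u ∧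
      (T ^ (n + 1)) ((D ^ n) u) = 0 := by
  have hTM : ∀ m, ∀ x ∈ M, (T ^ m) x ∈ M := fun m => by
    induction m with
    | zero => exact fun x hx => hx
    | succ m ih => exact fun x hx => by rw [pow_succ']; exact hT _ (ih x hx)
  have hDM : ∀ m, ∀ x ∈ M, (D ^ m) x ∈ M := fun m => by
    induction m with
    | zero => exact fun x hx => hx
    | succ m ih => exact fun x hx => by rw [pow_succ']; exact hD _ (ih x hx)
  -- Leibniz rule for `T ^ (m + 1)`, by iterating the commutation relation.
  have hcomm : ∀ m : ℕ, ∀ x ∈ M, (T ^ (m + 1)) (D x) = D ((T ^ (m + 1)) x) +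
      ((m + 1 : ℂ) * e) • (T ^ (m + 1)) x + ((m + 1 : ℂ) * c) • (T ^ m) x := fun m => by
    induction m with
    | zero => exact fun x hx => by simpa using h x hx
    | succ m ih =>
      intro x hx
      rw [pow_succ' T (m + 1), Module.End.mul_apply, ih x hx]
      simp only [map_add, map_smul]
      rw [h _ (hTM _ x hx), ← Module.End.mul_apply T (T ^ m), ← pow_succ', Module.End.mul_apply]
      push_cast
      module
  induction n with
  | zero => simp [hTu]
  | succ n ih =>
    have ih3 : (T ^ (n + 2)) ((D ^ n) u) = 0 := by
      rw [pow_succ', Module.End.mul_apply, ih.2, map_zero]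
    rw [pow_succ' D, Module.End.mul_apply, hcomm n _ (hDM n u hu), hcomm (n + 1) _ (hDM n u hu),
      ih.1, ih.2, ih3, Nat.factorial_succ]
    simp only [map_zero, smul_zero, zero_add, smul_smul, and_true]
    push_cast
    congr 1
    ring

/-- The vectors `∑ n < N, D ^ n (u n)` with `u n` in `K`. -/
def powSum (D : Module.End ℂ V) (K : Submodule ℂ V) (N : ℕ) : Submodule ℂ V :=
  ⨆ n : Fin N, K.map (D ^ (n : ℕ))

theorem powSum_succ (D : Module.End ℂ V) (K : Submodule ℂ V) (N : ℕ) :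
    powSum D K (N + 1) = powSum D K N ⊔ K.map (D ^ N) := by
  refine le_antisymm (iSup_le fun n => ?_) (sup_le (iSup_le fun n => ?_) ?_)
  · rcases Nat.lt_succ_iff_lt_or_eq.mp n.2 with hn | hn
    · exact le_sup_of_le_left (le_iSup (fun n : Fin N => K.map (D ^ (n : ℕ))) ⟨n, hn⟩)
    · rw [hn]
      exact le_sup_right
  · exact le_iSup (fun n : Fin (N + 1) => K.map (D ^ (n : ℕ))) n.castSucc
  · exact le_iSup (fun n : Fin (N + 1) => K.map (D ^ (n : ℕ))) (Fin.last N)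

/-- A nonzero vector of a `T`-stable subspace `S` in `∑ n < N, D ^ n K` yields a nonzero vector of
`S` in `K`, if `T` kills `K`. -/
theorem exists_ne_zero_mem_of_mem_powSum {T D : Module.End ℂ V} {M K S : Submodule ℂ V} {e c : ℂ}
    (hc : c ≠ 0) (hT : ∀ x ∈ M, T x ∈ M) (hD : ∀ x ∈ M, D x ∈ M)
    (h : ∀ x ∈ M, T (D x) = D (T x) + e • T x + c • x) (hKM : K ≤ M) (hTK : ∀ x ∈ K, T x = 0)
    (hS : ∀ x ∈ S, T x ∈ S) (N : ℕ) {v : V} (hvS : v ∈ S) (hv0 : v ≠ 0) (hv : v ∈ powSum D K N) :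
    ∃ u ∈ K, u ∈ S ∧ u ≠ 0 := by
  have hkill : ∀ N, ∀ x ∈ powSum D K N, (T ^ N) x = 0 := fun N x hx => by
    suffices powSum D K N ≤ LinearMap.ker (T ^ N) from this hx
    refine iSup_le fun n => ?_
    rintro _ ⟨u, hu, rfl⟩
    obtain ⟨m, hm⟩ := Nat.exists_eq_add_of_lt n.2
    rw [LinearMap.mem_ker, show T ^ N = T ^ m * T ^ ((n : ℕ) + 1) by rw [← pow_add]; congr 1; omega,
      Module.End.mul_apply, (pow_apply_pow_of_comm hT hD h (hKM hu) (hTK u hu) n).2, map_zero]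
  have hSN : ∀ m, ∀ x ∈ S, (T ^ m) x ∈ S := fun m => by
    induction m with
    | zero => exact fun x hx => hx
    | succ m ih => exact fun x hx => by rw [pow_succ']; exact hS _ (ih x hx)
  induction N with
  | zero => exact absurd (hkill 0 v hv) hv0
  | succ N ih =>
    rw [powSum_succ] at hv
    obtain ⟨y, hy, _, ⟨u, hu, rfl⟩, rfl⟩ := Submodule.mem_sup.mp hv
    by_cases hu0 : u = 0
    · subst hu0
      exact ih (by simpa using hy)
    -- `T ^ N` kills the lower terms `y` and turns the top term into `N! c ^ N u`.
    · have hmem := hSN N _ hvS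
      rw [map_add, hkill N y hy, zero_add,
        (pow_apply_pow_of_comm hT hD h (hKM hu) (hTK u hu) N).1] at hmem
      exact ⟨_, K.smul_mem _ hu, hmem, smul_ne_zero
        (mul_ne_zero (by exact_mod_cast N.factorial_ne_zero) (pow_ne_zero _ hc)) hu0⟩

/-- The smallest subspace containing `w` and stable under `D j`, `j ≥ i`. -/
def cyclicSpan (D : ℕ → Module.End ℂ V) (w : V) (i : ℕ) : Submodule ℂ V :=
  sInf {S | w ∈ S ∧ ∀ j, i ≤ j → ∀ x ∈ S, D j x ∈ S}

variable {D : ℕ → Module.End ℂ V} {w : V}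

theorem self_mem_cyclicSpan (i : ℕ) : w ∈ cyclicSpan D w i :=
  Submodule.mem_sInf.mpr fun _ hS => hS.1

theorem apply_mem_cyclicSpan {i j : ℕ} (hij : i ≤ j) {x : V} (hx : x ∈ cyclicSpan D w i) :
    D j x ∈ cyclicSpan D w i :=
  Submodule.mem_sInf.mpr fun S hS => hS.2 j hij x (Submodule.mem_sInf.mp hx S hS)

theorem cyclicSpan_le {i : ℕ} {S : Submodule ℂ V} (hw : w ∈ S)
    (hS : ∀ j, i ≤ j → ∀ x ∈ S, D j x ∈ S) : cyclicSpan D w i ≤ S :=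
  sInf_le ⟨hw, hS⟩

theorem cyclicSpan_anti {i j : ℕ} (hij : i ≤ j) : cyclicSpan D w j ≤ cyclicSpan D w i :=
  cyclicSpan_le (self_mem_cyclicSpan i) fun _ hj _ hx => apply_mem_cyclicSpan (hij.trans hj) hx

/-- Normal ordering: passing `D j` across `D i` only creates `D (j + i)`, again of index above `i`,
so the power of `D i` never grows. -/
theorem apply_pow_apply_mem (hD : IsWittRep 0 D) (i N : ℕ) :
    ∀ j, i < j → ∀ u ∈ cyclicSpan D w (i + 1),
      D j ((D i ^ N) u) ∈ powSum (D i) (cyclicSpan D w (i + 1)) (N + 1) := by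
  have hmap : ∀ N, ∀ x ∈ powSum (D i) (cyclicSpan D w (i + 1)) N,
      D i x ∈ powSum (D i) (cyclicSpan D w (i + 1)) (N + 1) := fun N x hx => by
    suffices powSum (D i) (cyclicSpan D w (i + 1)) N ≤
      (powSum (D i) (cyclicSpan D w (i + 1)) (N + 1)).comap (D i) from this hx
    refine iSup_le fun n => ?_
    rintro _ ⟨u, hu, rfl⟩
    exact Submodule.mem_iSup_of_mem n.succ ⟨u, hu, by simp [pow_succ']⟩
  induction N with
  | zero =>
    intro j hj u hu
    exact Submodule.mem_iSup_of_mem 0 ⟨D j u, apply_mem_cyclicSpan hj hu, rfl⟩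
  | succ N ih =>
    intro j hj u hu
    rw [pow_succ', Module.End.mul_apply, hD j i j.zero_le i.zero_le]
    refine add_mem (hmap _ _ (ih j hj u hu)) (Submodule.smul_mem _ _ ?_)
    rw [powSum_succ]
    exact Submodule.mem_sup_left (ih (j + i) (by omega) u hu)

theorem exists_mem_powSum (hD : IsWittRep 0 D) {i : ℕ} {x : V} (hx : x ∈ cyclicSpan D w i) :
    ∃ N, x ∈ powSum (D i) (cyclicSpan D w (i + 1)) N := by
  have hmono : Monotone (powSum (D i) (cyclicSpan D w (i + 1))) :=
    monotone_nat_of_le_succ fun N => by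
      rw [powSum_succ]
      exact le_sup_left
  suffices h : cyclicSpan D w i ≤ ⨆ N, powSum (D i) (cyclicSpan D w (i + 1)) N from
    (Submodule.mem_iSup_of_directed _ hmono.directed_le).mp (h hx)
  have hpow : ∀ n, ∀ u ∈ cyclicSpan D w (i + 1),
      (D i ^ n) u ∈ ⨆ N, powSum (D i) (cyclicSpan D w (i + 1)) N := fun n u hu =>
    Submodule.mem_iSup_of_mem (n + 1) (Submodule.mem_iSup_of_mem (Fin.last n) ⟨u, hu, rfl⟩)
  refine cyclicSpan_le (hpow 0 w (self_mem_cyclicSpan _)) fun j hj => ?_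
  suffices ⨆ N, powSum (D i) (cyclicSpan D w (i + 1)) N ≤
    (⨆ N, powSum (D i) (cyclicSpan D w (i + 1)) N).comap (D j) from fun x hx => this hx
  refine iSup_le fun N => iSup_le fun n => ?_
  rintro _ ⟨u, hu, rfl⟩
  rw [Submodule.mem_comap]
  rcases hj.eq_or_lt with rfl | hj
  · rw [← Module.End.mul_apply, ← pow_succ']
    exact hpow _ u hu
  · exact Submodule.mem_iSup_of_mem _ (apply_pow_apply_mem hD i n j hj u hu)

/-! ### Action of the high-index operators and the reduction to `w` -/

variable {k r : ℕ} {f : ℕ → ℂ}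

/-- The `d j` with `j > r` span an ideal that kills `w`, hence kills all that `w` generates. -/
theorem apply_eq_zero_of_lt (hD : IsWittRep 0 D) (hw : ∀ i, k ≤ i → D i w = f i • w)
    (hkr : k ≤ r) (hf : ∀ i, r < i → f i = 0) {x : V} (hx : x ∈ cyclicSpan D w 0) :
    ∀ j, r < j → D j x = 0 := by
  suffices h : cyclicSpan D w 0 ≤ ⨅ (j : ℕ) (_ : r < j), LinearMap.ker (D j) by
    simpa [Submodule.mem_iInf] using h hx
  refine cyclicSpan_le ?_ fun j _ x hx => ?_
  · simp only [Submodule.mem_iInf, LinearMap.mem_ker]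
    intro j hj
    rw [hw j (by omega), hf j hj, zero_smul]
  · simp only [Submodule.mem_iInf, LinearMap.mem_ker] at hx ⊢
    intro m hm
    rw [hD m j m.zero_le j.zero_le, hx m hm, hx (m + j) (by omega), map_zero, smul_zero, add_zero]

/-- Commuting `D m` past `D j`, `j ≥ i`, produces `D (m + j)` with `m + j > r`, which acts by zero.
-/
theorem apply_eq_smul_of_lt_add (hD : IsWittRep 0 D) (hw : ∀ i, k ≤ i → D i w = f i • w)
    (hkr : k ≤ r) (hf : ∀ i, r < i → f i = 0) {i m : ℕ} (hm : k ≤ m) (him : r < m + i) {x : V}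
    (hx : x ∈ cyclicSpan D w i) : D m x = f m • x := by
  suffices h : cyclicSpan D w i ≤
      cyclicSpan D w 0 ⊓ LinearMap.ker (D m - f m • (1 : Module.End ℂ V)) by
    have := (h hx).2
    rwa [SetLike.mem_coe, LinearMap.mem_ker, LinearMap.sub_apply, LinearMap.smul_apply,
      Module.End.one_apply, sub_eq_zero] at this
  refine cyclicSpan_le ⟨self_mem_cyclicSpan 0, ?_⟩ fun j hj x hx => ⟨?_, ?_⟩
  · simp [hw m hm]
  · exact apply_mem_cyclicSpan j.zero_le hx.1
  · have h1 := LinearMap.mem_ker.mp hx.2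
    rw [LinearMap.sub_apply, LinearMap.smul_apply, Module.End.one_apply, sub_eq_zero] at h1
    rw [SetLike.mem_coe, LinearMap.mem_ker, LinearMap.sub_apply, LinearMap.smul_apply,
      Module.End.one_apply, sub_eq_zero, hD m j m.zero_le j.zero_le, h1,
      apply_eq_zero_of_lt hD hw hkr hf hx.1 (m + j) (by omega), map_smul, smul_zero, add_zero]

/-- One step of the reduction, from `cyclicSpan D w i` to `cyclicSpan D w (i + 1)`. -/
theorem exists_ne_zero_mem_cyclicSpan_succ (hD : IsWittRep 0 D)
    (hw : ∀ i, k ≤ i → D i w = f i • w) (hkr : 2 * k ≤ r + 1) (hfr : f r ≠ 0)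
    (hf : ∀ i, r < i → f i = 0) {S : Submodule ℂ V} (hS : ∀ j, ∀ x ∈ S, D j x ∈ S) {i : ℕ}
    (hi : i < k) {v : V} (hv : v ∈ cyclicSpan D w i) (hvS : v ∈ S) (hv0 : v ≠ 0) :
    ∃ u ∈ cyclicSpan D w (i + 1), u ∈ S ∧ u ≠ 0 := by
  obtain ⟨N, hN⟩ := exists_mem_powSum hD hv
  have hri : r - i + i = r := by omega
  have hk : k ≤ r := by omega
  have hcast : ((r - i : ℕ) : ℂ) = (r : ℂ) - i := by rw [Nat.cast_sub (by omega)]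
  have hc : ((r : ℂ) - 2 * i) * f r ≠ 0 := by
    refine mul_ne_zero ?_ hfr
    rw [sub_ne_zero]
    exact_mod_cast (show r ≠ 2 * i by omega)
  -- The commutator with `D i` is `(r - 2 i) D r`. For `i > 0`, `D r` is the scalar `f r` on this
  -- subspace; for `i = 0` it is `T + f r`, whence `e = r`.
  refine exists_ne_zero_mem_of_mem_powSum (T := D (r - i) - f (r - i) • 1) (M := cyclicSpan D w i)
    (e := if i = 0 then (r : ℂ) else 0) hc (fun x hx => ?_)
    (fun x hx => apply_mem_cyclicSpan le_rfl hx) (fun x hx => ?_) (cyclicSpan_anti i.le_succ)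
    (fun x hx => ?_) (fun x hx => ?_) N hvS hv0 hN
  · exact sub_mem (apply_mem_cyclicSpan (by omega) hx) (Submodule.smul_mem _ _ hx)
  · simp only [LinearMap.sub_apply, LinearMap.smul_apply, Module.End.one_apply, map_sub, map_smul]
    rw [hD (r - i) i (Nat.zero_le _) i.zero_le, hri, hcast]
    split_ifs with h
    · subst h
      simp only [Nat.sub_zero, Nat.cast_zero]
      module
    · rw [apply_eq_smul_of_lt_add hD hw hk hf hk (by omega) hx]
      module
  · rw [LinearMap.sub_apply, LinearMap.smul_apply, Module.End.one_apply,
      apply_eq_smul_of_lt_add hD hw hk hf (by omega) (by omega) hx, sub_self]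
  · exact sub_mem (hS _ x hx) (S.smul_mem _ hx)

/-- If `f r ≠ 0` with `r ≥ 2 k - 1` and `f` vanishes beyond `r`, then every nonzero stable
subspace of the module generated by `w` contains `w`. -/
theorem generator_mem_of_stable (hD : IsWittRep 0 D)
    (hw : ∀ i, k ≤ i → D i w = f i • w) (hkr : 2 * k ≤ r + 1) (hfr : f r ≠ 0)
    (hf : ∀ i, r < i → f i = 0) {S : Submodule ℂ V} (hS : ∀ j, ∀ x ∈ S, D j x ∈ S)
    {v : V} (hv : v ∈ cyclicSpan D w 0) (hvS : v ∈ S) (hv0 : v ≠ 0) : w ∈ S := by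
  have h : ∀ i ≤ k, ∃ u ∈ cyclicSpan D w i, u ∈ S ∧ u ≠ 0 := fun i => by
    induction i with
    | zero => exact fun _ => ⟨v, hv, hvS, hv0⟩
    | succ i ih =>
      intro hi
      obtain ⟨u, hu, huS, hu0⟩ := ih (by omega)
      exact exists_ne_zero_mem_cyclicSpan_succ hD hw hkr hfr hf hS hi hu huS hu0
  obtain ⟨u, hu, huS, hu0⟩ := h k le_rfl
  have hle : cyclicSpan D w k ≤ Submodule.span ℂ {w} :=
    cyclicSpan_le (Submodule.mem_span_singleton_self w) fun j hj x hx => by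
      obtain ⟨a, rfl⟩ := Submodule.mem_span_singleton.mp hx
      rw [map_smul, hw j hj]
      exact Submodule.smul_mem _ _ (Submodule.smul_mem _ _ (Submodule.mem_span_singleton_self w))
  obtain ⟨a, rfl⟩ := Submodule.mem_span_singleton.mp (hle hu)
  have ha : a ≠ 0 := fun ha => hu0 (by rw [ha, zero_smul])
  simpa [smul_smul, ha] using S.smul_mem a⁻¹ huS

end Reduction
end

noncomputable section

/-! ## Universal property of the quasi-Whittaker module -/

section Universal

attribute [local instance 100] LieRing.ofAssociativeRing

variable {L : Type*} [LieRing L] [LieAlgebra ℂ L] {𝔭 : LieIdeal ℂ L}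

/-- The lift of `ι` to `A`, followed by the inclusion, is the identity by the universal property. -/
theorem mem_subalgebra_of_ι_mem (A : Subalgebra ℂ (UniversalEnvelopingAlgebra ℂ L))
    (hA : ∀ y, UniversalEnvelopingAlgebra.ι ℂ y ∈ A) (u : UniversalEnvelopingAlgebra ℂ L) :
    u ∈ A := by
  let g : L →ₗ⁅ℂ⁆ A :=
    { toFun := fun y => ⟨UniversalEnvelopingAlgebra.ι ℂ y, hA y⟩
      map_add' := fun y z => Subtype.ext (map_add _ y z)
      map_smul' := fun c y => Subtype.ext (map_smul _ c y)
      map_lie' := fun {y z} => Subtype.ext (LieHom.map_lie _ y z) }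
  have h : A.val.comp (UniversalEnvelopingAlgebra.lift ℂ g) = AlgHom.id ℂ _ :=
    UniversalEnvelopingAlgebra.hom_ext (h := LieHom.ext fun y => by
      change ((UniversalEnvelopingAlgebra.lift ℂ g (UniversalEnvelopingAlgebra.ι ℂ y) : A) :
        UniversalEnvelopingAlgebra ℂ L) = UniversalEnvelopingAlgebra.ι ℂ y
      rw [UniversalEnvelopingAlgebra.lift_ι_apply]
      rfl)
  have hu := AlgHom.congr_fun h u
  rw [AlgHom.id_apply] at hu
  rw [← hu]
  exact (UniversalEnvelopingAlgebra.lift ℂ g u).2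

namespace UniversalQuasiWhittaker

/-- The canonical generator `1 ⊗ w_φ`. -/
def gen (φ : LieAlgebra.LieCharacter ℂ 𝔭) : UniversalQuasiWhittaker φ :=
  Submodule.Quotient.mk (1 ⊗ₜ[ℂ] (1 : ℂ))

variable (φ : LieAlgebra.LieCharacter ℂ 𝔭)

theorem mk_tmul (u : UniversalEnvelopingAlgebra ℂ L) (c : ℂ) :
    (Submodule.Quotient.mk (u ⊗ₜ[ℂ] c) : UniversalQuasiWhittaker φ) = (c • u) • gen φ := by
  change _ = Submodule.Quotient.mk (((c • u) * 1) ⊗ₜ[ℂ] (1 : ℂ))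
  rw [mul_one, TensorProduct.smul_tmul, smul_eq_mul, mul_one]

theorem exists_smul_gen (x : UniversalQuasiWhittaker φ) :
    ∃ u : UniversalEnvelopingAlgebra ℂ L, x = u • gen φ := by
  obtain ⟨t, rfl⟩ := Submodule.Quotient.mk_surjective (balancedRelations (characterRep φ)) x
  induction t using TensorProduct.induction_on with
  | zero => exact ⟨0, (zero_smul _ _).symm⟩
  | add s t hs ht =>
    obtain ⟨a, ha⟩ := hs
    obtain ⟨b, hb⟩ := ht
    exact ⟨a + b, by rw [add_smul, ← ha, ← hb]; rfl⟩
  | tmul u c => exact ⟨_, mk_tmul φ u c⟩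

theorem lie_gen (x : 𝔭) : ⁅(x : L), gen φ⁆ = φ x • gen φ := by
  have hrel : (1 * envelopingIncl 𝔭 (UniversalEnvelopingAlgebra.ι ℂ x)) ⊗ₜ[ℂ] (1 : ℂ) -
      (1 : UniversalEnvelopingAlgebra ℂ L) ⊗ₜ[ℂ] (UniversalEnvelopingAlgebra.lift ℂ
        (characterRep φ) (UniversalEnvelopingAlgebra.ι ℂ x) 1) ∈
      balancedRelations (characterRep φ) := Submodule.subset_span ⟨1, _, 1, rfl⟩
  have h := (Submodule.Quotient.eq _).mpr hrel
  rw [envelopingIncl, UniversalEnvelopingAlgebra.lift_ι_apply,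
    UniversalEnvelopingAlgebra.lift_ι_apply, one_mul] at h
  change Submodule.Quotient.mk ((_ * 1) ⊗ₜ[ℂ] (1 : ℂ)) = Submodule.Quotient.mk (φ x • (1 ⊗ₜ[ℂ] 1))
  rw [mul_one, ← TensorProduct.tmul_smul]
  exact h

theorem envelopingAlgebra_smul_mem (N : LieSubmodule ℂ L (UniversalQuasiWhittaker φ))
    (u : UniversalEnvelopingAlgebra ℂ L) : ∀ x ∈ N, u • x ∈ N := by
  let A : Subalgebra ℂ (UniversalEnvelopingAlgebra ℂ L) :=
    { carrier := {u | ∀ x ∈ N, u • x ∈ N}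
      mul_mem' := fun {a b} ha hb x hx => by
        rw [mul_smul]
        exact ha _ (hb x hx)
      add_mem' := fun {a b} ha hb x hx => by
        rw [add_smul]
        exact add_mem (ha x hx) (hb x hx)
      algebraMap_mem' := fun c x hx => by
        rw [algebraMap_smul]
        exact N.smul_mem c hx }
  exact mem_subalgebra_of_ι_mem A (fun y x hx => N.lie_mem hx) u

theorem eq_top_of_gen_mem (N : LieSubmodule ℂ L (UniversalQuasiWhittaker φ)) (h : gen φ ∈ N) :
    N = ⊤ := by
  rw [eq_top_iff]
  rintro x -
  obtain ⟨u, rfl⟩ := exists_smul_gen φ x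
  exact envelopingAlgebra_smul_mem φ N u _ h

theorem exists_hom_apply_gen {V : Type*} [AddCommGroup V] [Module ℂ V] (ρ : L →ₗ⁅ℂ⁆ Module.End ℂ V)
    (v : V) (hv : ∀ x : 𝔭, ρ x v = φ x • v) :
    ∃ F : UniversalQuasiWhittaker φ →ₗ[ℂ] V, F (gen φ) = v ∧ ∀ (x : L) m, F ⁅x, m⁆ = ρ x (F m) := by
  let Φ := UniversalEnvelopingAlgebra.lift ℂ ρ
  let G : (UniversalEnvelopingAlgebra ℂ L) ⊗[ℂ] ℂ →ₗ[ℂ] V :=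
    LinearMap.applyₗ v ∘ₗ Φ.toLinearMap ∘ₗ (TensorProduct.rid ℂ _).toLinearMap
  have hGt : ∀ u c, G (u ⊗ₜ[ℂ] c) = c • Φ u v := fun u c => by
    simp [G]
  have hG : ∀ (u : UniversalEnvelopingAlgebra ℂ L) t, G (u • t) = Φ u (G t) := fun u t => by
    induction t using TensorProduct.induction_on with
    | zero => simp
    | add s t hs ht => rw [smul_add, map_add, map_add, map_add, hs, ht]
    | tmul a c =>
      rw [TensorProduct.smul_tmul', hGt, hGt, smul_eq_mul, map_mul, Module.End.mul_apply, map_smul]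
  have hn : ∀ (a : UniversalEnvelopingAlgebra ℂ 𝔭) (n : ℂ),
      UniversalEnvelopingAlgebra.lift ℂ (characterRep φ) a n =
        n * UniversalEnvelopingAlgebra.lift ℂ (characterRep φ) a 1 := fun a n => by
    rw [← smul_eq_mul, ← map_smul, smul_eq_mul, mul_one]
  -- `U(𝔭)` acts on `v` through the character; this makes `G` vanish on the balanced relations.
  have hscalar : ∀ a : UniversalEnvelopingAlgebra ℂ 𝔭,
      Φ (envelopingIncl 𝔭 a) v = UniversalEnvelopingAlgebra.lift ℂ (characterRep φ) a 1 • v := by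
    let A : Subalgebra ℂ (UniversalEnvelopingAlgebra ℂ 𝔭) :=
      { carrier := {a | Φ (envelopingIncl 𝔭 a) v =
          UniversalEnvelopingAlgebra.lift ℂ (characterRep φ) a 1 • v}
        mul_mem' := fun {a b} ha hb => by
          rw [Set.mem_ofPred_eq] at ha hb ⊢
          rw [map_mul, map_mul, map_mul, Module.End.mul_apply, Module.End.mul_apply, hb, map_smul,
            ha, smul_smul, hn a (UniversalEnvelopingAlgebra.lift ℂ (characterRep φ) b 1)]
        add_mem' := fun {a b} ha hb => by
          rw [Set.mem_ofPred_eq] at ha hb ⊢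
          simp only [map_add, LinearMap.add_apply, ha, hb, add_smul]
        algebraMap_mem' := fun c => by
          simp [Module.algebraMap_end_apply] }
    refine mem_subalgebra_of_ι_mem A fun y => ?_
    change Φ (envelopingIncl 𝔭 (UniversalEnvelopingAlgebra.ι ℂ y)) v =
      UniversalEnvelopingAlgebra.lift ℂ (characterRep φ) (UniversalEnvelopingAlgebra.ι ℂ y) 1 • v
    rw [envelopingIncl, UniversalEnvelopingAlgebra.lift_ι_apply,
      UniversalEnvelopingAlgebra.lift_ι_apply]
    change Φ (UniversalEnvelopingAlgebra.ι ℂ (y : L)) v = (φ y • (1 : ℂ)) • v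
    rw [UniversalEnvelopingAlgebra.lift_ι_apply, hv, smul_eq_mul, mul_one]
  have hker : (balancedRelations (characterRep φ)).restrictScalars ℂ ≤ LinearMap.ker G := by
    intro t ht
    rw [LinearMap.mem_ker]
    change t ∈ balancedRelations (characterRep φ) at ht
    induction ht using Submodule.span_induction with
    | zero => exact map_zero G
    | add s t _ _ hs ht => rw [map_add, hs, ht, add_zero]
    | smul u t _ ht => rw [hG, ht, map_zero]
    | mem t ht =>
      obtain ⟨u, a, n, rfl⟩ := ht
      rw [map_sub, hGt, hGt, map_mul, Module.End.mul_apply, hscalar, map_smul, smul_smul, hn a n,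
        sub_self]
  let F : (UniversalEnvelopingAlgebra ℂ L ⊗[ℂ] ℂ) ⧸ balancedRelations (characterRep φ) →ₗ[ℂ] V :=
    ((balancedRelations (characterRep φ)).restrictScalars ℂ).liftQ G hker ∘ₗ
      (Submodule.Quotient.restrictScalarsEquiv ℂ (balancedRelations (characterRep φ))).symm
  refine ⟨{ toFun := F, map_add' := F.map_add, map_smul' := F.map_smul }, ?_, ?_⟩
  · change G (1 ⊗ₜ[ℂ] 1) = v
    rw [hGt, map_one, one_smul, Module.End.one_apply]
  · intro x m
    obtain ⟨t, rfl⟩ := Submodule.Quotient.mk_surjective (balancedRelations (characterRep φ)) m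
    change G (UniversalEnvelopingAlgebra.ι ℂ x • t) = ρ x (G t)
    rw [hG, UniversalEnvelopingAlgebra.lift_ι_apply]

end UniversalQuasiWhittaker

end Universal
end

/-! ### Characters of `𝔭ₖ` and the irreducibility criterion -/

noncomputable section

namespace WittBorel

attribute [local instance 100] LieRing.ofAssociativeRing

/-- The representation of `W₁⁺⁺` given by operators with the relations of the `d i`. -/
def repOfOperators {V : Type*} [AddCommGroup V] [Module ℂ V] (D : ℕ → Module.End ℂ V)
    (hD : IsWittRep 0 D) : WittBorel →ₗ⁅ℂ⁆ Module.End ℂ V :=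
  { basis.constr ℂ D with
    map_lie' := fun {x y} => by
      change basis.constr ℂ D ⁅x, y⁆ = ⁅basis.constr ℂ D x, basis.constr ℂ D y⁆
      have hd : ∀ i, basis.constr ℂ D (d i) = D i := basis.constr_basis ℂ D
      induction x using d_induction with
      | h0 => simp
      | hadd a b ha hb => rw [add_lie, map_add, map_add, ha, hb, add_lie]
      | hsmul c a ha => rw [smul_lie, map_smul, map_smul, ha, smul_lie]
      | hd m =>
        induction y using d_induction with
        | h0 => simp
        | hadd a b ha hb => rw [lie_add, map_add, map_add, ha, hb, lie_add]
        | hsmul c a ha => rw [lie_smul, map_smul, map_smul, ha, lie_smul]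
        | hd n =>
          rw [d_lie_d, map_smul, hd, hd, hd, LieRing.of_associative_ring_bracket]
          refine LinearMap.ext fun x => ?_
          simp [hD m n m.zero_le n.zero_le x] }

theorem repOfOperators_d {V : Type*} [AddCommGroup V] [Module ℂ V] (D : ℕ → Module.End ℂ V)
    (hD : IsWittRep 0 D) (i : ℕ) : repOfOperators D hD (d i) = D i :=
  basis.constr_basis ℂ D i

theorem p_induction {k : ℕ} {P : p k → Prop} (hd : ∀ i (hi : k ≤ i), P (dp k i hi)) (h0 : P 0)
    (hadd : ∀ x y, P x → P y → P (x + y)) (hsmul : ∀ (c : ℂ) x, P x → P (c • x))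
    (x : p k) : P x := by
  obtain ⟨x, hx⟩ := x
  change x ∈ Submodule.span ℂ (d '' Set.Ici k) at hx
  induction hx using Submodule.span_induction with
  | mem y hy =>
    obtain ⟨i, hi, rfl⟩ := hy
    exact hd i hi
  | zero => exact h0
  | add y z hy hz ihy ihz => exact hadd ⟨y, hy⟩ ⟨z, hz⟩ ihy ihz
  | smul c y hy ih => exact hsmul c ⟨y, hy⟩ ih

variable {k : ℕ} (φ : LieAlgebra.LieCharacter ℂ (p k))

/-- The values `φ (d i)`, extended by zero to `i < k`. -/
def charVal (i : ℕ) : ℂ := if h : k ≤ i then φ (dp k i h) else 0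

theorem charVal_of_le {i : ℕ} (hi : k ≤ i) : charVal φ i = φ (dp k i hi) := dif_pos hi

theorem sub_mul_charVal_add {m n : ℕ} (hm : k ≤ m) (hn : k ≤ n) :
    ((m : ℂ) - n) * charVal φ (m + n) = 0 := by
  have h := LieAlgebra.lieCharacter_apply_lie φ (dp k m hm) (dp k n hn)
  have hb : ⁅dp k m hm, dp k n hn⁆ = ((m : ℂ) - n) • dp k (m + n) (by omega) :=
    Subtype.ext (d_lie_d m n)
  rwa [hb, map_smul, smul_eq_mul, ← charVal_of_le] at h

/-- `d i` is a nonzero multiple of `⁅d k, d (i - k)⁆`, as `i - k > k`. -/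
theorem charVal_of_two_mul_lt {i : ℕ} (hi : 2 * k < i) : charVal φ i = 0 := by
  have h := sub_mul_charVal_add φ (m := k) (n := i - k) le_rfl (by omega)
  rw [show k + (i - k) = i by omega] at h
  refine (mul_eq_zero.mp h).resolve_left ?_
  refine sub_ne_zero.mpr ?_
  exact_mod_cast (show k ≠ i - k by omega)

/-- Any `W₁⁺⁺`-module with a vector of type `φ` receives a morphism from `W(φ)`. -/
theorem exists_hom_of_operators {V : Type*} [AddCommGroup V] [Module ℂ V]
    (D : ℕ → Module.End ℂ V) (hD : IsWittRep 0 D) (v : V)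
    (hv : ∀ i, k ≤ i → D i v = charVal φ i • v) :
    ∃ F : UniversalQuasiWhittaker φ →ₗ[ℂ] V, F (UniversalQuasiWhittaker.gen φ) = v ∧
      ∀ i m, F ⁅d i, m⁆ = D i (F m) := by
  obtain ⟨F, hF, hFD⟩ := UniversalQuasiWhittaker.exists_hom_apply_gen φ (repOfOperators D hD) v
    fun x => by
      induction x using p_induction with
      | hd i hi =>
        change repOfOperators D hD (d i) v = _
        rw [repOfOperators_d, hv i hi, charVal_of_le φ hi]
      | h0 => simp
      | hadd x y hx hy =>
        rw [LieSubmodule.coe_add, map_add, LinearMap.add_apply, hx, hy, map_add, add_smul]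
      | hsmul c x hx =>
        rw [LieSubmodule.coe_smul, map_smul, LinearMap.smul_apply, hx, map_smul, smul_assoc]
  exact ⟨F, hF, fun i m => by rw [hFD, repOfOperators_d]⟩

theorem gen_ne_zero : UniversalQuasiWhittaker.gen φ ≠ 0 := by
  obtain ⟨V, _, _, D, v, hD, hv0, hv⟩ := exists_wittRep_apply_eq k (charVal φ)
    fun m n hm hn => sub_mul_charVal_add φ hm hn
  obtain ⟨F, hF, -⟩ := exists_hom_of_operators φ D hD v hv
  intro h
  rw [h, map_zero] at hF
  exact hv0 hF.symm

/-- The operators of the `d i` on a module. -/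
def operators (M : Type*) [AddCommGroup M] [Module ℂ M] [LieRingModule WittBorel M]
    [LieModule ℂ WittBorel M] (i : ℕ) : Module.End ℂ M :=
  LieModule.toEnd ℂ WittBorel M (d i)

theorem isWittRep_operators (M : Type*) [AddCommGroup M] [Module ℂ M] [LieRingModule WittBorel M]
    [LieModule ℂ WittBorel M] : IsWittRep 0 (operators M) := by
  intro m n _ _ x
  change ⁅d m, ⁅d n, x⁆⁆ = ⁅d n, ⁅d m, x⁆⁆ + ((m : ℂ) - n) • ⁅d (m + n), x⁆
  rw [leibniz_lie, d_lie_d, smul_lie, add_comm]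

/-- A subspace stable under the `d i` as a submodule over `W₁⁺⁺`. -/
def lieSubmoduleOfStable {M : Type*} [AddCommGroup M] [Module ℂ M] [LieRingModule WittBorel M]
    [LieModule ℂ WittBorel M] (S : Submodule ℂ M) (hS : ∀ i, ∀ x ∈ S, ⁅d i, x⁆ ∈ S) :
    LieSubmodule ℂ WittBorel M :=
  { S with
    lie_mem := fun {x m} hm => by
      change ⁅x, m⁆ ∈ S
      induction x using d_induction with
      | hd i => exact hS i m hm
      | h0 => simp
      | hadd x y hx hy =>
        rw [add_lie]
        exact add_mem hx hy
      | hsmul c x hx =>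
        rw [smul_lie]
        exact S.smul_mem c hx }

theorem cyclicSpan_gen_eq_top :
    cyclicSpan (operators (UniversalQuasiWhittaker φ)) (UniversalQuasiWhittaker.gen φ) 0 = ⊤ := by
  have h := UniversalQuasiWhittaker.eq_top_of_gen_mem φ
    (lieSubmoduleOfStable (cyclicSpan (operators _) (UniversalQuasiWhittaker.gen φ) 0)
      fun i _ hx => apply_mem_cyclicSpan i.zero_le hx) (self_mem_cyclicSpan 0)
  exact congrArg LieSubmodule.toSubmodule h

theorem isIrreducible_of_charVal_ne_zero {r : ℕ} (hkr : 2 * k ≤ r + 1) (hr : charVal φ r ≠ 0)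
    (hφ : ∀ i, r < i → charVal φ i = 0) :
    LieModule.IsIrreducible ℂ WittBorel (UniversalQuasiWhittaker φ) := by
  have : Nontrivial (UniversalQuasiWhittaker φ) := ⟨_, _, gen_ne_zero φ⟩
  refine LieModule.IsIrreducible.mk fun N hN => ?_
  obtain ⟨v, hvN, hv0⟩ := N.toSubmodule.exists_mem_ne_zero_of_ne_bot fun h =>
    hN ((LieSubmodule.toSubmodule_eq_bot N).mp h)
  refine UniversalQuasiWhittaker.eq_top_of_gen_mem φ N ?_
  refine generator_mem_of_stable (isWittRep_operators (UniversalQuasiWhittaker φ)) (k := k)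
    (f := charVal φ) (fun i hi => ?_) hkr hr hφ (S := N.toSubmodule)
    (fun j x hx => N.lie_mem hx) (v := v) ?_ hvN hv0
  · rw [charVal_of_le φ hi]
    exact UniversalQuasiWhittaker.lie_gen φ (dp k i hi)
  · rw [cyclicSpan_gen_eq_top]
    exact Submodule.mem_top

/-- If `φ` vanishes on `d (2 k - 1)` and `d (2 k)`, it extends to `𝔭 (k - 1)` with an arbitrary
value `c` on `d (k - 1)`, so `d (k - 1) w = c w` whenever `W(φ)` is irreducible. -/
theorem lie_gen_eq_of_isIrreducible (hk : 2 ≤ k) (h1 : charVal φ (2 * k - 1) = 0)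
    (h2 : charVal φ (2 * k) = 0)
    (hirr : LieModule.IsIrreducible ℂ WittBorel (UniversalQuasiWhittaker φ)) (c : ℂ) :
    ⁅d (k - 1), UniversalQuasiWhittaker.gen φ⁆ = c • UniversalQuasiWhittaker.gen φ := by
  obtain ⟨V, _, _, D, v, hD, hv0, hv⟩ := exists_wittRep_apply_eq (k - 1)
    (Function.update (charVal φ) (k - 1) c) fun m n hm hn => by
      -- `m + n ≥ 2k - 2 > k - 1` because `k ≥ 2`, so the new value `c` is never met on brackets.
      rw [Function.update_of_ne (by omega)]
      by_cases hmn : m + n = 2 * k - 2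
      · rw [show m = n by omega, sub_self, zero_mul]
      · refine mul_eq_zero_of_right _ ?_
        by_cases ha : m + n = 2 * k - 1
        · rw [ha, h1]
        · by_cases hb : m + n = 2 * k
          · rw [hb, h2]
          · exact charVal_of_two_mul_lt φ (by omega)
  obtain ⟨F, hF, hFD⟩ := exists_hom_of_operators φ D hD v fun i hi => by
    rw [hv i (by omega), Function.update_of_ne (by omega)]
  let N := lieSubmoduleOfStable (LinearMap.ker F) fun i x hx => by
    rw [LinearMap.mem_ker] at hx ⊢
    rw [hFD, hx, map_zero]
  -- The kernel is proper, since `F` sends the generator to `v ≠ 0`.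
  have hN : N = ⊥ := by
    refine (eq_bot_or_eq_top N).resolve_right fun htop => hv0 ?_
    have hmem : UniversalQuasiWhittaker.gen φ ∈ N := htop ▸ LieSubmodule.mem_top _
    exact hF.symm.trans hmem
  have hmem : ⁅d (k - 1), UniversalQuasiWhittaker.gen φ⁆ - c • UniversalQuasiWhittaker.gen φ ∈ N := by
    change F _ = 0
    rw [map_sub, hFD, map_smul, hF, hv _ le_rfl, Function.update_self, sub_self]
  rw [hN, LieSubmodule.mem_bot] at hmem
  exact sub_eq_zero.mp hmem

theorem eq_zero_of_charVal_eq_zero (h : ∀ i, k ≤ i → charVal φ i = 0) : φ = 0 := by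
  refine LieHom.ext fun x => ?_
  rw [LieHom.zero_apply]
  induction x using p_induction with
  | hd i hi => rw [← charVal_of_le, h i hi]
  | h0 => exact map_zero φ
  | hadd x y hx hy => rw [map_add, hx, hy, add_zero]
  | hsmul c x hx => rw [map_smul, hx, smul_zero]

end WittBorel

end

theorem mainTheorem11 (k : ℕ) (hk : 1 ≤ k)
    (φ : LieAlgebra.LieCharacter ℂ (WittBorel.p k)) (hφ : φ ≠ 0) :
    LieModule.IsIrreducible ℂ WittBorel (UniversalQuasiWhittaker φ) ↔
      φ (WittBorel.dp k (2 * k - 1) (by omega)) ≠ 0 ∨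
        φ (WittBorel.dp k (2 * k) (by omega)) ≠ 0 := by
  rw [← WittBorel.charVal_of_le, ← WittBorel.charVal_of_le]
  constructor
  · intro hirr
    by_contra! hcon
    obtain ⟨h1, h2⟩ := hcon
    rcases hk.eq_or_lt with rfl | hk
    · refine hφ (WittBorel.eq_zero_of_charVal_eq_zero φ fun i hi => ?_)
      by_cases ha : i = 1
      · rw [ha]
        exact h1
      · by_cases hb : i = 2
        · rw [hb]
          exact h2
        · exact WittBorel.charVal_of_two_mul_lt φ (by omega)
    -- The values `c = 0` and `c = 1` together give `w = 0`.
    · have h0 := WittBorel.lie_gen_eq_of_isIrreducible φ hk h1 h2 hirr 0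
      rw [WittBorel.lie_gen_eq_of_isIrreducible φ hk h1 h2 hirr 1, one_smul, zero_smul] at h0
      exact WittBorel.gen_ne_zero φ h0
  · intro h
    by_cases h2 : WittBorel.charVal φ (2 * k) = 0
    · refine WittBorel.isIrreducible_of_charVal_ne_zero φ (r := 2 * k - 1) (by omega)
        (h.resolve_right (not_not_intro h2)) fun i hi => ?_
      by_cases hi2 : i = 2 * k
      · rw [hi2, h2]
      · exact WittBorel.charVal_of_two_mul_lt φ (by omega)
    · exact WittBorel.isIrreducible_of_charVal_ne_zero φ (r := 2 * k) (by omega) h2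
        fun i hi => WittBorel.charVal_of_two_mul_lt φ hi
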